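/- Let $(V,d)$ be a finite metric space with $n=|V|$ points and diameter $M$, and let $1\le k\le n$. For $U,C\subseteq V$ with $|C|=k$ put $\mathrm{cost}(U,C)=\sum_{x\in U} d(x,C)^2$, where $d(x,C)=\min_{c\in C}d(x,c)$. Put $\mathrm{opt}(U)=\min_{C\subseteq V,\,|C|=k}\mathrm{cost}(U,C)$, $\mathrm{cost}^{\mathrm{mean}}_{\mathrm{avg}}(U,C)=\mathrm{cost}(U,C)/|U|$ (and $0$ if $U=\emptyset$) and $\mathrm{mean}_{\mathrm{avg}}(D,k)=\mathrm{opt}(D)/|D|$. A randomized algorithm that maps each data set $S\subseteq V$ to a set of $k$ centers in $V$ is $\epsilon$-DP if $\Pr[\mathcal A(S)\in E]\le e^{\epsilon}\Pr[\mathcal A(S')\in E]$ for all sets $E$ of outputs and all $S,S'$ such that one arises from the other by adding one point. It is an $(\alpha,\gamma)$-approximation $k$-means algorithm with failure probability at most $p$ if for every $S\subseteq V$, with probability at least $1-p$, its output $C$ satisfies $\mathrm{cost}(S,C)\le\alpha\,\mathrm{opt}(S)+\gamma$. It runs in time $T$ if on every $S$ it halts after at most $T(|S|)$ steps. For $\xi\in[0,1]$,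 the sampling scheme $\mathcal A'$ on input $D\subseteq V$ draws a random $S\subseteq D$ that contains each element of $D$ independently with probability $\xi$, runs $\mathcal A$ on $S$, and outputs the resulting set of centers $C^*$. **Theorem.** There is an absolute constant $c>0$ such that the following holds for all $V,k$ as above, $\epsilon>0$, $K\ge0$, $p\in[0,1]$, $\xi\in[0,1]$ and $T:\mathbb N\to\mathbb N$. Let $\gamma=K\,\frac{M^2k^4}{\epsilon}\log^2 n$ and let $\mathcal A$ be an $\epsilon$-DP $(30,\gamma)$-approximation $k$-means algorithm with failure probability at most $p$ that runs in time $T$. Then $\mathcal A'$ is $\epsilon'$-DP with $$\epsilon'=\ln\max\left\{\xi(e^{\epsilon}-1)+1,\ \bigl(\xi(e^{-\epsilon}-1)+1\bigr)^{-1}\right\}.$$ Moreover, for all nonempty $D\subseteq V$, $0<\theta<1$ and $\eta>0$ put $$s_0=c\cdot\max\left\{\frac{M^2\ln(1/\theta)}{\eta},\ \frac{M^4}{\eta^2}\bigl(\ln(1/\theta)+k\ln n\bigr)\right\}.$$ Then $\mathcal A'$ computes $C^*$ from its sample $S\subseteq D$ in at most $T(|S|)$ steps, and: 1. for every integer $s\ge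 s_0$ such that $|S|=s$ has positive probability, conditionally on $|S|=s$, with probability at least $(1-\theta)(1-p)$ both $\mathrm{cost}^{\mathrm{mean}}_{\mathrm{avg}}(D,C^*)$ and $\mathrm{cost}^{\mathrm{mean}}_{\mathrm{avg}}(S,C^*)$ are at most $30\,\mathrm{mean}_{\mathrm{avg}}(D,k)+\gamma+\eta$; 2. if the expected sample size $\xi|D|$ is at least $s_0$, the same two bounds hold unconditionally with probability at least $(1-\theta)(1-p)$. In particular the probability is at least $1-\theta$ if $\mathcal A$ always achieves its approximation guarantee ($p=0$), and at least $0.99(1-\theta)$ if $\mathcal A$ achieves it with probability at least $0.99$, as the private $k$-means algorithm of Balcan et al. does. -/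

import Mathlib

open scoped ENNReal NNReal

universe u v w

namespace PrivateClustering

noncomputable section

/-! ### Randomized algorithms with a step count -/

/-- The law of the configuration of a randomized machine with one-step kernel `step`, started in
state `q`, after `t` steps. A configuration is either a state `Sum.inl q'` (still running) or
`Sum.inr (o, i)`: the machine has halted at its `i`-th step with output `o`. Halted
configurations are absorbing. -/
def runSteps {σ : Type w} {O : Type v} (step : σ → PMF (σ ⊕ O)) (q : σ) :
    ℕ → PMF (σ ⊕ (O × ℕ))
  | 0 => PMF.pure (Sum.inl q)
  | t + 1 => (runSteps step q t).bind
      (Sum.elim (fun q' => (step q').map (Sum.map id (fun o => (o, t + 1))))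
        (fun r => PMF.pure (Sum.inr r)))

/-- A randomized algorithm: a randomized machine (an arbitrary set of states, an initial state for
each input and a probabilistic transition, which either moves to a new state or halts with an
output) that halts on every input, after boundedly many steps. -/
structure RandAlg (I : Type u) (O : Type v) where
  State : Type w
  init : I → State
  step : State → PMF (State ⊕ O)
  halts : ∀ x, ∃ t, ∀ z ∈ (runSteps step (init x) t).support, z.isRight = true

namespace RandAlg

variable {I : Type u} {O : Type v}

open Classical in
/-- The joint law of (output, number of steps) of a randomized algorithm on input `x`: the law of
the halted configuration, at the first time by which the machine has halted surely. -/
def law (A : RandAlg.{u, v, w} I O) (x : I) : PMF (O × ℕ) :=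
  (runSteps A.step (A.init x) (Nat.find (A.halts x))).bindOnSupport
    (fun z hz => PMF.pure (z.getRight (Nat.find_spec (A.halts x) z hz)))

/-- The law of the output of a randomized algorithm on input `x`. -/
def outputLaw (A : RandAlg.{u, v, w} I O) (x : I) : PMF O :=
  (A.law x).map Prod.fst

end RandAlg

/-- An algorithm on data sets runs in time `T`: on an input of `m` points it always halts after at
most `T m` steps. -/
def RunsInTime {V : Type u} {O : Type v} (A : RandAlg.{u, v, w} (Finset V) O) (T : ℕ → ℕ) :
    Prop :=
  ∀ S : Finset V, ∀ r ∈ (A.law S).support, r.2 ≤ T S.card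

/-! ### Differential privacy -/

/-- Two data sets are neighboring if one arises from the other by adding one point. -/
def Neighboring {V : Type u} (D D' : Finset V) : Prop :=
  (D ⊆ D' ∧ D'.card = D.card + 1) ∨ (D' ⊆ D ∧ D.card = D'.card + 1)

/-- `ε`-differential privacy of a mechanism, given by the law of its output on each data set. -/
def IsDP {V : Type u} {O : Type v} (mech : Finset V → PMF O) (ε : ℝ) : Prop :=
  ∀ D D' : Finset V, Neighboring D D' → ∀ E : Set O,
    (mech D).toOuterMeasure E ≤ ENNReal.ofReal (Real.exp ε) * (mech D').toOuterMeasure E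

/-! ### k-means clustering -/

section KMeans

variable {V : Type u} [MetricSpace V]

/-- Sets of exactly `k` centers. -/
abbrev Centers (V : Type u) (k : ℕ) : Type u := {C : Finset V // C.card = k}

/-- The total k-means cost `∑ x ∈ U, d(x, C)²`. -/
def meansCost (U C : Finset V) : ℝ :=
  ∑ x ∈ U, Metric.infDist x (C : Set V) ^ 2

/-- The total cost of an optimum k-means clustering of `U`, with centers anywhere in `V`. -/
def optMeansCost (U : Finset V) (k : ℕ) : ℝ :=
  ⨅ C : Centers V k, meansCost U C.1

/-- The average k-means cost of the centers `C` on `U`. -/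
def costMeanAvg (U C : Finset V) : ℝ := meansCost U C / U.card

/-- The average cost of an optimum k-means clustering of `D`. -/
def meanAvg (D : Finset V) (k : ℕ) : ℝ := optMeansCost D k / D.card

/-- `A` is an `(α, γ)`-approximation algorithm for k-means with failure probability at most `p`:
on every input `S`, with probability at least `1 - p`, the total cost of its output is at most
`α` times the optimum plus `γ`. -/
def IsApproxKMeans {k : ℕ} (A : RandAlg.{u, u, w} (Finset V) (Centers V k)) (α γ p : ℝ) : Prop :=
  ∀ S : Finset V, ENNReal.ofReal (1 - p) ≤
    (A.outputLaw S).toOuterMeasure {C | meansCost S C.1 ≤ α * optMeansCost S k + γ}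

end KMeans

/-! ### The sampling scheme -/

/-- The law of a random subset of `D` that contains each element of `D` independently with
probability `ξ`. -/
def sampleLaw {V : Type u} (ξ : ℝ≥0) (hξ : ξ ≤ 1) (D : Finset V) : PMF (Finset V) := by
  classical
  exact PMF.ofFinset
    (fun S => if S ⊆ D then ((ξ ^ S.card * (1 - ξ) ^ (D.card - S.card) : ℝ≥0) : ℝ≥0∞) else 0)
    D.powerset
    (by
      rw [Finset.sum_congr rfl (fun S hS => if_pos (Finset.mem_powerset.mp hS)),
        ← ENNReal.ofNNReal_finsetSum, Finset.sum_pow_mul_eq_add_pow, add_tsub_cancel_of_le hξ]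
      simp)
    (fun S hS => if_neg (fun h => hS (Finset.mem_powerset.mpr h)))

/-- The general sampling scheme on input `D`: sample each element of `D` independently with
probability `ξ`, run `A` on the sample. This is the joint law of (sample, (clustering, number of
steps that the computation of the clustering from the sample takes)). -/
def schemeLaw {V : Type u} {O : Type v} (A : RandAlg.{u, v, w} (Finset V) O) (ξ : ℝ≥0)
    (hξ : ξ ≤ 1) (D : Finset V) : PMF (Finset V × (O × ℕ)) :=
  (sampleLaw ξ hξ D).bind (fun S => (A.law S).map (fun r => (S, r)))

/-- The law of the output (the clustering only) of the general sampling scheme. -/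
def schemeOutput {V : Type u} {O : Type v} (A : RandAlg.{u, v, w} (Finset V) O) (ξ : ℝ≥0)
    (hξ : ξ ≤ 1) (D : Finset V) : PMF O :=
  (schemeLaw A ξ hξ D).map (fun ω => ω.2.1)

/-- The privacy parameter `ε'` of the sampling scheme. -/
def subsampledEps (ε : ℝ) (ξ : ℝ≥0) : ℝ :=
  Real.log (max ((ξ : ℝ) * (Real.exp ε - 1) + 1) ((ξ : ℝ) * (Real.exp (-ε) - 1) + 1)⁻¹)

end

end PrivateClustering

/-!
The privacy claim is amplification by subsampling. If `D' = D ∪ {x}`, condition on the part `S ⊆ D`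
of the sample: on input `D` the algorithm runs on `S`, on input `D'` it runs on `S` with probability
`1 - ξ` and on `S ∪ {x}` with probability `ξ`. Privacy of `A` bounds the two output probabilities
against each other within a factor `e ^ ε`, so the mixture lies between `1 + ξ (e ^ (-ε) - 1)` and
`1 + ξ (e ^ ε - 1)` times the probability on `S`; these are the two terms of the maximum that
defines `ε'` (`isDP_schemeOutput`).

For accuracy, call a sample `S` representative (`Represents`) if for every set `C` of `k` centers the
average costs of `C` on `S` and on `D` differ by less than `η / 60`. On such a sample the optimal
centers of `D` cost at most `meanAvg D k + η / 60` on average, so an output that meets the guarantee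
of `A` costs at most `30 * meanAvg D k + η / 2 + γ` on `S`, and only `η / 60` more on `D`
(`costMeanAvg_le_of_represents`). It remains to see that samples are representative with probability
at least `1 - θ`.

* Given its size `s`, the sample is a uniformly random `s`-subset of `D`. Hoeffding's inequality for
  sampling without replacement (`card_filter_powersetCard_le`), with a union bound over the at most
  `n ^ k` sets of centers, bounds the share of subsets that are not representative by
  `2 n ^ k exp (-s (η / 60) ^ 2 / (2 M ^ 4))` (`card_not_represents_le`). The moment generating
  function is bounded by induction on `s`, revealing one point of the sample at a time.
* Without conditioning, a Chernoff bound (`sum_bernoulli_small_le`) shows that the sample has at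
  least half of its expected size, up to probability `exp (-ξ |D| / 10)`.

Both error terms are at most `θ / 2` once `s₀ ≥ 50000 (M ^ 4 / η ^ 2) (ln (1 / θ) + k ln n)` and
`η < M ^ 2`; if `η ≥ M ^ 2`, the bounds hold for every choice of centers. The condition `n ≥ 2`,
automatic for `M > 0`, lets `k ln n` absorb the constant factors of the union bounds.
-/

namespace PrivateClustering

/-! ### Hoeffding's inequality for sampling without replacement -/

section WithoutReplacement

/-- Double counting of the pairs of an `(s + 1)`-subset of `D` and a point of it: a uniformly random
`(s + 1)`-subset is a uniformly random point `x` with a uniformly random `s`-subset of `D.erase x`. -/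
theorem succ_mul_sum_powersetCard {V : Type*} [DecidableEq V] (D : Finset V) (s : ℕ) (F : Finset V → ℝ) :
    ((s : ℝ) + 1) * ∑ S ∈ D.powersetCard (s + 1), F S =
      ∑ x ∈ D, ∑ S ∈ (D.erase x).powersetCard s, F (insert x S) := by
  have h1 : ((s : ℝ) + 1) * ∑ S ∈ D.powersetCard (s + 1), F S =
      ∑ S ∈ D.powersetCard (s + 1), ∑ _x ∈ S, F S := by
    rw [Finset.mul_sum]
    refine Finset.sum_congr rfl fun S hS => ?_
    rw [Finset.sum_const, (Finset.mem_powersetCard.mp hS).2, nsmul_eq_mul]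
    push_cast
    rfl
  rw [h1, Finset.sum_comm' (t' := D) (s' := fun x => {S ∈ D.powersetCard (s + 1) | x ∈ S})]
  · refine Finset.sum_congr rfl fun x hx => ?_
    refine Finset.sum_bij' (fun S _ => S.erase x) (fun S _ => insert x S) ?_ ?_ ?_ ?_ ?_
    · intro S hS
      simp only [Finset.mem_filter, Finset.mem_powersetCard] at hS ⊢
      exact ⟨Finset.erase_subset_erase x hS.1.1, by rw [Finset.card_erase_of_mem hS.2]; omega⟩
    · intro S hS
      simp only [Finset.mem_filter, Finset.mem_powersetCard] at hS ⊢
      have hxS : x ∉ S := fun h => Finset.notMem_erase x D (hS.1 h)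
      exact ⟨⟨Finset.insert_subset hx (hS.1.trans (Finset.erase_subset x D)),
        by rw [Finset.card_insert_of_notMem hxS, hS.2]⟩, Finset.mem_insert_self x S⟩
    · intro S hS
      exact Finset.insert_erase (Finset.mem_filter.mp hS).2
    · intro S hS
      have hxS : x ∉ S := fun h =>
        Finset.notMem_erase x D ((Finset.mem_powersetCard.mp hS).1 h)
      exact Finset.erase_insert hxS
    · intro S hS
      rw [Finset.insert_erase (Finset.mem_filter.mp hS).2]
  · intro S x
    simp only [Finset.mem_filter, Finset.mem_powersetCard]
    exact ⟨fun h => ⟨⟨h.1, h.2⟩, h.1.1 h.2⟩, fun h => ⟨h.1.1, h.1.2⟩⟩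

/-- A version of Hoeffding's lemma for the uniform distribution on `D`, with a constant that is not
optimal: by convexity, `exp` lies on `[-R, R]` below its chord, whose mean is `cosh R`. -/
theorem sum_exp_le_card_mul_exp {V : Type*} (D : Finset V) (g : V → ℝ) (R : ℝ) (hg : ∑ x ∈ D, g x = 0)
    (hR : ∀ x ∈ D, |g x| ≤ R) : ∑ x ∈ D, Real.exp (g x) ≤ D.card * Real.exp (R ^ 2 / 2) := by
  have key : ∀ x ∈ D, Real.exp (g x) ≤ Real.cosh R + g x / R * Real.sinh R := by
    intro x hx
    rcases eq_or_ne R 0 with rfl | hR0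
    · have : g x = 0 := abs_nonpos_iff.mp (hR x hx)
      simp [this]
    · have hRpos : 0 < R := lt_of_le_of_ne ((abs_nonneg _).trans (hR x hx)) hR0.symm
      have := Real.exp_mul_le_cosh_add_mul_sinh (t := g x / R)
        (by rw [abs_div, abs_of_pos hRpos]; exact (div_le_one hRpos).mpr (hR x hx)) R
      rwa [div_mul_cancel₀ _ hR0] at this
  calc ∑ x ∈ D, Real.exp (g x) ≤ ∑ x ∈ D, (Real.cosh R + g x / R * Real.sinh R) :=
        Finset.sum_le_sum key
    _ = D.card * Real.cosh R := by
        rw [Finset.sum_add_distrib, ← Finset.sum_mul, ← Finset.sum_div, hg]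
        simp
    _ ≤ D.card * Real.exp (R ^ 2 / 2) := by
        gcongr
        exact Real.cosh_le_exp_half_sq R

/-- The moment generating function of the centered sum of `f` over a uniformly random `s`-subset of
`D`, at the argument `1` (a general argument is absorbed into `f`). -/
theorem sum_powersetCard_exp_le {V : Type*} [DecidableEq V] (s : ℕ) (D : Finset V) (f : V → ℝ) (R : ℝ)
    (hR : ∀ x ∈ D, ∀ y ∈ D, f x - f y ≤ R) (hs : s ≤ D.card) :
    ∑ S ∈ D.powersetCard s, Real.exp (∑ x ∈ S, f x - s * ((∑ x ∈ D, f x) / D.card)) ≤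
      D.card.choose s * Real.exp (s * (R ^ 2 / 2)) := by
  induction s generalizing D with
  | zero => simp
  | succ s ih =>
    have hm : 0 < D.card := by omega
    have hm' : (0 : ℝ) < D.card := by exact_mod_cast hm
    set m : ℝ := (D.card : ℝ) with hmdef
    set μ : ℝ := (∑ x ∈ D, f x) / m with hμ
    have hμm : ∑ x ∈ D, f x = m * μ := by rw [hμ]; field_simp
    -- Revealing that `x` is in the sample moves the conditional mean of the sum by `a * (f x - μ)`,
    -- as the mean of `f` over `D.erase x` moves the other way. For `m = 1` one has `s = 0`, and
    -- `a = 1` by the convention for division by zero.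
    set a : ℝ := 1 - s / (m - 1) with ha
    have hsm : (s : ℝ) ≤ m - 1 := by
      have : ((s + 1 : ℕ) : ℝ) ≤ m := by rw [hmdef]; exact_mod_cast hs
      push_cast at this; linarith
    have hs0 : (0 : ℝ) ≤ s := Nat.cast_nonneg s
    have ha0 : 0 ≤ a := by
      have : (s : ℝ) / (m - 1) ≤ 1 := div_le_one_of_le₀ hsm (hs0.trans hsm)
      linarith
    have ha1 : a ≤ 1 := by
      have : (0 : ℝ) ≤ (s : ℝ) / (m - 1) := div_nonneg hs0 (hs0.trans hsm)
      linarith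
    have hdev : ∀ x ∈ D, |f x - μ| ≤ R := by
      intro x hx
      have e : f x - μ = (∑ y ∈ D, (f x - f y)) / m := by
        rw [Finset.sum_sub_distrib, hμm, Finset.sum_const, nsmul_eq_mul, ← hmdef]
        field_simp
      rw [e, abs_div, abs_of_pos hm', div_le_iff₀ hm']
      calc |∑ y ∈ D, (f x - f y)| ≤ ∑ y ∈ D, |f x - f y| := Finset.abs_sum_le_sum_abs _ _
        _ ≤ ∑ y ∈ D, R := Finset.sum_le_sum fun y hy =>
            abs_le.mpr ⟨by linarith [hR y hy x hx], hR x hx y hy⟩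
        _ = R * m := by rw [Finset.sum_const, nsmul_eq_mul, mul_comm]
    have step : ∀ x ∈ D, ∑ S ∈ (D.erase x).powersetCard s,
        Real.exp (∑ y ∈ insert x S, f y - ((s + 1 : ℕ) : ℝ) * μ) ≤
        (D.card - 1).choose s * Real.exp (s * (R ^ 2 / 2)) * Real.exp (a * (f x - μ)) := by
      intro x hx
      have hc : (D.erase x).card = D.card - 1 := Finset.card_erase_of_mem hx
      have hcr : ((D.erase x).card : ℝ) = m - 1 := by
        rw [hc, Nat.cast_sub hm, Nat.cast_one]
      have h := ih (D.erase x)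
        (fun y hy z hz => hR y (Finset.mem_of_mem_erase hy) z (Finset.mem_of_mem_erase hz))
        (by omega)
      rw [hc] at h
      refine le_trans (le_of_eq ?_) (mul_le_mul_of_nonneg_right h (Real.exp_nonneg _))
      rw [Finset.sum_mul]
      refine Finset.sum_congr rfl fun S hS => ?_
      have hxS : x ∉ S := fun h' =>
        Finset.notMem_erase x D ((Finset.mem_powersetCard.mp hS).1 h')
      rw [← Real.exp_add, Finset.sum_insert hxS, ← hc, hcr]
      congr 1
      have hers : ∑ y ∈ D.erase x, f y = m * μ - f x := by
        rw [← hμm, ← Finset.add_sum_erase D f hx]; ring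
      rw [hers, ha]
      push_cast
      rcases eq_or_ne (m - 1) 0 with h0 | h0
      · have : (s : ℝ) = 0 := by linarith
        rw [this]; ring
      · field_simp
        ring
    have hexp := sum_exp_le_card_mul_exp D (fun x => a * (f x - μ)) R
      (by
        rw [← Finset.mul_sum, Finset.sum_sub_distrib, hμm, Finset.sum_const, nsmul_eq_mul]
        ring)
      (fun x hx => by
        rw [abs_mul, abs_of_nonneg ha0]
        calc a * |f x - μ| ≤ 1 * |f x - μ| := by gcongr
          _ ≤ R := by rw [one_mul]; exact hdev x hx)
    have hchoose : m * ((D.card - 1).choose s : ℝ) =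
        ((s : ℝ) + 1) * (D.card.choose (s + 1) : ℝ) := by
      have := Nat.add_one_mul_choose_eq (D.card - 1) s
      rw [Nat.sub_add_cancel hm] at this
      rw [hmdef, mul_comm ((s : ℝ) + 1)]
      exact_mod_cast this
    refine le_of_mul_le_mul_left ?_ (by positivity : (0 : ℝ) < (s : ℝ) + 1)
    rw [succ_mul_sum_powersetCard]
    calc _ ≤ ∑ x ∈ D,
          (D.card - 1).choose s * Real.exp (s * (R ^ 2 / 2)) * Real.exp (a * (f x - μ)) :=
        Finset.sum_le_sum step
      _ ≤ (D.card - 1).choose s * Real.exp (s * (R ^ 2 / 2)) * (m * Real.exp (R ^ 2 / 2)) := by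
        rw [← Finset.mul_sum]
        gcongr
      _ = (m * ((D.card - 1).choose s : ℝ)) *
          (Real.exp (s * (R ^ 2 / 2)) * Real.exp (R ^ 2 / 2)) := by ring
      _ = _ := by
        rw [hchoose, ← Real.exp_add]
        push_cast
        ring_nf

/-- **Hoeffding's inequality** for sampling without replacement: few `s`-subsets of `D` have a mean
of `f` that exceeds the mean over `D` by `t`. -/
theorem card_filter_powersetCard_le {V : Type*} [DecidableEq V] (s : ℕ) (D : Finset V) (f : V → ℝ) (R t : ℝ)
    (hR0 : 0 < R) (ht : 0 ≤ t)
    (hR : ∀ x ∈ D, ∀ y ∈ D, f x - f y ≤ R) (hs : s ≤ D.card) :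
    (({S ∈ D.powersetCard s |
        s * ((∑ x ∈ D, f x) / D.card + t) ≤ ∑ x ∈ S, f x} : Finset (Finset V)).card : ℝ) ≤
      D.card.choose s * Real.exp (-(s * t ^ 2 / (2 * R ^ 2))) := by
  set μ : ℝ := (∑ x ∈ D, f x) / D.card with hμ
  -- the optimal parameter in Markov's inequality for `exp (l * sum)`
  set l : ℝ := t / R ^ 2 with hl
  have hl0 : 0 ≤ l := by positivity
  have hmgf := sum_powersetCard_exp_le s D (fun x => l * f x) (l * R)
    (fun x hx y hy => by
      have := mul_le_mul_of_nonneg_left (hR x hx y hy) hl0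
      linarith) hs
  have hmarkov : (({S ∈ D.powersetCard s | s * (μ + t) ≤ ∑ x ∈ S, f x} :
      Finset (Finset V)).card : ℝ) * Real.exp (l * (s * t)) ≤
      D.card.choose s * Real.exp (s * ((l * R) ^ 2 / 2)) := by
    refine le_trans ?_ hmgf
    rw [← nsmul_eq_mul, ← Finset.sum_const]
    refine (Finset.sum_le_sum fun S hS => ?_).trans
      (Finset.sum_le_sum_of_subset_of_nonneg (Finset.filter_subset _ _)
        fun _ _ _ => Real.exp_nonneg _)
    have h := mul_le_mul_of_nonneg_left (Finset.mem_filter.mp hS).2 hl0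
    refine Real.exp_le_exp.mpr ?_
    rw [← Finset.mul_sum, ← Finset.mul_sum, mul_div_assoc, ← hμ]
    linarith
  rw [← le_div_iff₀ (Real.exp_pos _), mul_div_assoc, ← Real.exp_sub] at hmarkov
  refine hmarkov.trans (le_of_eq ?_)
  congr 2
  rw [hl]
  field_simp
  ring

end WithoutReplacement

/-! ### Representative samples -/

section Accuracy

variable {V : Type u} [MetricSpace V]

theorem sq_infDist_le_sq_diam [Fintype V] (x : V) (C : Finset V) (hC : C.Nonempty) :
    Metric.infDist x (C : Set V) ^ 2 ≤ Metric.diam (Set.univ : Set V) ^ 2 := by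
  obtain ⟨c, hc⟩ := hC
  refine pow_le_pow_left₀ Metric.infDist_nonneg ?_ 2
  exact (Metric.infDist_le_dist_of_mem (Finset.mem_coe.mpr hc)).trans
    (Metric.dist_le_diam_of_mem Set.finite_univ.isBounded (Set.mem_univ x) (Set.mem_univ c))

theorem costMeanAvg_le_sq_diam [Fintype V] (U C : Finset V) (hC : C.Nonempty) :
    costMeanAvg U C ≤ Metric.diam (Set.univ : Set V) ^ 2 := by
  refine div_le_of_le_mul₀ (Nat.cast_nonneg _) (sq_nonneg _) ?_
  rw [meansCost, mul_comm, ← nsmul_eq_mul]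
  exact Finset.sum_le_card_nsmul _ _ _ fun x _ => sq_infDist_le_sq_diam x C hC

theorem two_le_card_of_diam_pos [Fintype V] (h : 0 < Metric.diam (Set.univ : Set V)) :
    2 ≤ Fintype.card V := by
  by_contra hn
  have : Subsingleton V := Fintype.card_le_one_iff_subsingleton.mp (by omega)
  exact h.ne' (Metric.diam_subsingleton Set.subsingleton_univ)

theorem exists_meansCost_eq_optMeansCost [Fintype V] (U : Finset V) {k : ℕ}
    (hk : k ≤ Fintype.card V) : ∃ C : Centers V k, meansCost U C.1 = optMeansCost U k := by
  obtain ⟨C, -, hC⟩ := Finset.exists_subset_card_eq (s := (Finset.univ : Finset V)) (n := k)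
    (by simpa using hk)
  have : Nonempty (Centers V k) := ⟨⟨C, hC⟩⟩
  exact exists_eq_ciInf_of_finite

theorem optMeansCost_nonneg (U : Finset V) (k : ℕ) : 0 ≤ optMeansCost U k :=
  Real.iInf_nonneg fun _ => Finset.sum_nonneg fun _ _ => sq_nonneg _

theorem optMeansCost_le [Fintype V] (U : Finset V) {k : ℕ} (C : Centers V k) :
    optMeansCost U k ≤ meansCost U C.1 :=
  ciInf_le (Set.finite_range _).bddBelow C

/-- A sample `S` represents `D` up to `t` if, for every choice of `k` centers, the average costs on
`S` and on `D` differ by less than `t`. The inequality is multiplied by `S.card`, so that the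
empty sample represents nothing. -/
def Represents (D : Finset V) (k : ℕ) (t : ℝ) (S : Finset V) : Prop :=
  ∀ C : Centers V k, |meansCost S C.1 - S.card * costMeanAvg D C.1| < S.card * t

/-- Few subsets of a given size are not representative: Hoeffding's inequality for the costs and for
their negatives, with a union bound over the at most `n ^ k` choices of centers. -/
theorem card_not_represents_le [Fintype V] {M : ℝ} (hM : M = Metric.diam (Set.univ : Set V))
    (hM0 : 0 < M) {k : ℕ} (hk : 1 ≤ k) {t : ℝ} (ht : 0 ≤ t) (D : Finset V) {s : ℕ}
    (hs : s ≤ D.card) [DecidablePred (Represents D k t)] :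
    (({S ∈ D.powersetCard s | ¬ Represents D k t S} : Finset (Finset V)).card : ℝ) ≤
      (2 * (Fintype.card V : ℝ) ^ k * Real.exp (-(s * t ^ 2 / (2 * (M ^ 2) ^ 2)))) *
        D.card.choose s := by
  classical
  set e : ℝ := Real.exp (-(s * t ^ 2 / (2 * (M ^ 2) ^ 2))) with he
  let f : Centers V k → V → ℝ := fun C x => Metric.infDist x (C.1 : Set V) ^ 2
  -- the samples that overestimate, respectively underestimate, the cost of `C`
  let up : Centers V k → Finset (Finset V) := fun C =>
    {S ∈ D.powersetCard s | s * ((∑ x ∈ D, f C x) / D.card + t) ≤ ∑ x ∈ S, f C x}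
  let lo : Centers V k → Finset (Finset V) := fun C =>
    {S ∈ D.powersetCard s | s * ((∑ x ∈ D, -f C x) / D.card + t) ≤ ∑ x ∈ S, -f C x}
  have hf : ∀ C x y, f C x - f C y ≤ M ^ 2 := fun C x y => by
    have hC : C.1.Nonempty := Finset.card_pos.mp (by rw [C.2]; omega)
    have h1 := sq_infDist_le_sq_diam x C.1 hC
    rw [← hM] at h1
    have h2 : 0 ≤ f C y := sq_nonneg _
    simp only [f] at h2 ⊢
    linarith
  have hup : ∀ C, ((up C).card : ℝ) ≤ D.card.choose s * e := fun C =>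
    card_filter_powersetCard_le s D (f C) (M ^ 2) t (by positivity) ht
      (fun x _ y _ => hf C x y) hs
  have hlo : ∀ C, ((lo C).card : ℝ) ≤ D.card.choose s * e := fun C =>
    card_filter_powersetCard_le s D (fun x => -f C x) (M ^ 2) t (by positivity) ht
      (fun x _ y _ => by linarith [hf C y x]) hs
  have hsub : ({S ∈ D.powersetCard s | ¬ Represents D k t S} : Finset (Finset V)) ⊆
      Finset.univ.biUnion fun C => up C ∪ lo C := by
    intro S hS
    obtain ⟨hS, hrep⟩ := Finset.mem_filter.mp hS
    have hcard := (Finset.mem_powersetCard.mp hS).2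
    simp only [Represents, not_forall, not_lt, hcard] at hrep
    obtain ⟨C, hC⟩ := hrep
    refine Finset.mem_biUnion.mpr ⟨C, Finset.mem_univ C, Finset.mem_union.mpr ?_⟩
    rcases le_abs.mp hC with h | h
    · left
      refine Finset.mem_filter.mpr ⟨hS, ?_⟩
      simp only [meansCost, costMeanAvg] at h
      simp only [f]
      linarith
    · right
      refine Finset.mem_filter.mpr ⟨hS, ?_⟩
      simp only [meansCost, costMeanAvg] at h
      simp only [f, Finset.sum_neg_distrib, neg_div]
      linarith
  have hcenters : (Fintype.card (Centers V k) : ℝ) ≤ (Fintype.card V : ℝ) ^ k := by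
    rw [Fintype.card_finset_len]
    exact_mod_cast Nat.choose_le_pow _ _
  calc (({S ∈ D.powersetCard s | ¬ Represents D k t S} : Finset (Finset V)).card : ℝ)
      ≤ ((∑ C : Centers V k, (up C ∪ lo C).card : ℕ) : ℝ) := by
        exact_mod_cast (Finset.card_le_card hsub).trans Finset.card_biUnion_le
    _ = ∑ C : Centers V k, ((up C ∪ lo C).card : ℝ) := by push_cast; rfl
    _ ≤ ∑ _C : Centers V k, 2 * (D.card.choose s * e) := by
        refine Finset.sum_le_sum fun C _ => ?_
        have : ((up C ∪ lo C).card : ℝ) ≤ (up C).card + (lo C).card := by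
          exact_mod_cast Finset.card_union_le _ _
        linarith [hup C, hlo C]
    _ = Fintype.card (Centers V k) * (2 * (D.card.choose s * e)) := by
        rw [Finset.sum_const, Finset.card_univ, nsmul_eq_mul]
    _ ≤ (Fintype.card V : ℝ) ^ k * (2 * (D.card.choose s * e)) := by gcongr
    _ = _ := by ring

/-- An approximately optimal clustering of a representative sample is good on the sample and on
the whole data set, since the optimal centers for `D` are among the competitors on the sample. -/
theorem costMeanAvg_le_of_represents [Fintype V] {k : ℕ} (hk : k ≤ Fintype.card V)
    {D S : Finset V} {γ η : ℝ} (hγ : 0 ≤ γ) (hη : 0 < η) (hrep : Represents D k (η / 60) S)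
    (C : Centers V k) (hC : meansCost S C.1 ≤ 30 * optMeansCost S k + γ) :
    costMeanAvg D C.1 ≤ 30 * meanAvg D k + γ + η ∧
      costMeanAvg S C.1 ≤ 30 * meanAvg D k + γ + η := by
  obtain ⟨C₀, hC₀⟩ := exists_meansCost_eq_optMeansCost D hk
  have hmean : costMeanAvg D C₀.1 = meanAvg D k := by rw [costMeanAvg, hC₀, meanAvg]
  have hs : 0 < (S.card : ℝ) := by
    have := (abs_nonneg _).trans_lt (hrep C)
    exact pos_of_mul_pos_left this (by positivity)
  have hs1 : (1 : ℝ) ≤ S.card := by exact_mod_cast Nat.cast_pos.mp hs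
  have h0 := (abs_lt.mp (hrep C₀)).2
  have h1 := (abs_lt.mp (hrep C)).1
  have hopt := optMeansCost_le S C₀
  rw [hmean] at h0
  have hγs : γ ≤ S.card * γ := le_mul_of_one_le_left hγ hs1
  have hηs : 0 < S.card * η := mul_pos hs hη
  constructor
  · refine le_of_mul_le_mul_left ?_ hs
    linarith
  · rw [costMeanAvg, div_le_iff₀ hs]
    linarith

end Accuracy

/-! ### Bernoulli sampling -/

/-- A Chernoff bound for the lower tail of the sample size, from Markov's inequality for
`exp (-S.card)`. -/
theorem sum_bernoulli_small_le {V : Type*} (D : Finset V) {ξ : ℝ} (h0 : 0 ≤ ξ) (h1 : ξ ≤ 1) :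
    ∑ S ∈ D.powerset with (S.card : ℝ) < ξ * D.card / 2,
      ξ ^ S.card * (1 - ξ) ^ (D.card - S.card) ≤ Real.exp (-(ξ * D.card / 10)) := by
  have h1' : 0 ≤ 1 - ξ := sub_nonneg.mpr h1
  have he : Real.exp (-1) ≤ 2 / 5 := by
    rw [Real.exp_neg]
    refine (inv_anti₀ (by norm_num) Real.exp_one_gt_d9.le).trans (by norm_num)
  calc ∑ S ∈ D.powerset with (S.card : ℝ) < ξ * D.card / 2,
      ξ ^ S.card * (1 - ξ) ^ (D.card - S.card)
      ≤ ∑ S ∈ D.powerset with (S.card : ℝ) < ξ * D.card / 2,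
        Real.exp (ξ * D.card / 2) *
          ((ξ * Real.exp (-1)) ^ S.card * (1 - ξ) ^ (D.card - S.card)) := by
        refine Finset.sum_le_sum fun S hS => ?_
        have hS' := (Finset.mem_filter.mp hS).2
        have : (1 : ℝ) ≤ Real.exp (ξ * D.card / 2) * Real.exp (-1) ^ S.card := by
          rw [← Real.exp_nat_mul, ← Real.exp_add]
          exact Real.one_le_exp (by linarith)
        calc ξ ^ S.card * (1 - ξ) ^ (D.card - S.card)
            ≤ (Real.exp (ξ * D.card / 2) * Real.exp (-1) ^ S.card) *
              (ξ ^ S.card * (1 - ξ) ^ (D.card - S.card)) :=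
              le_mul_of_one_le_left (by positivity) this
          _ = _ := by rw [mul_pow]; ring
    _ ≤ ∑ S ∈ D.powerset, Real.exp (ξ * D.card / 2) *
          ((ξ * Real.exp (-1)) ^ S.card * (1 - ξ) ^ (D.card - S.card)) :=
        Finset.sum_le_sum_of_subset_of_nonneg (Finset.filter_subset _ _)
          fun _ _ _ => by positivity
    _ = Real.exp (ξ * D.card / 2) * (ξ * Real.exp (-1) + (1 - ξ)) ^ D.card := by
        rw [← Finset.mul_sum, Finset.sum_pow_mul_eq_add_pow]
    _ ≤ Real.exp (ξ * D.card / 2) * Real.exp (-(ξ * (3 / 5))) ^ D.card := by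
        gcongr
        have h2 : ξ * Real.exp (-1) ≤ ξ * (2 / 5) := by gcongr
        linarith [Real.add_one_le_exp (-(ξ * (3 / 5)))]
    _ = Real.exp (-(ξ * D.card / 10)) := by
        rw [← Real.exp_nat_mul, ← Real.exp_add]
        congr 1
        ring

/-! Bounds for the probability that the sample satisfies a predicate `B`, from bounds for the share
of the subsets of each size that satisfy it. -/

section Bernoulli

variable {V : Type*} (D : Finset V) (B : Finset V → Prop) [DecidablePred B] {ξ δ : ℝ}

/-- All samples of size `s` are equally likely. -/
theorem sum_bernoulli_card_eq_le (s : ℕ) (h0 : 0 ≤ ξ) (h1 : ξ ≤ 1)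
    (hB : (({S ∈ D.powersetCard s | B S} : Finset (Finset V)).card : ℝ) ≤ δ * D.card.choose s) :
    ∑ S ∈ D.powersetCard s with B S, ξ ^ S.card * (1 - ξ) ^ (D.card - S.card) ≤
      δ * ∑ S ∈ D.powersetCard s, ξ ^ S.card * (1 - ξ) ^ (D.card - S.card) := by
  have h1' : 0 ≤ 1 - ξ := sub_nonneg.mpr h1
  have hw : ∀ S ∈ D.powersetCard s, ξ ^ S.card * (1 - ξ) ^ (D.card - S.card) =
      ξ ^ s * (1 - ξ) ^ (D.card - s) := fun S hS => by
    rw [(Finset.mem_powersetCard.mp hS).2]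
  rw [Finset.sum_congr rfl hw,
    Finset.sum_congr rfl fun S hS => hw S (Finset.mem_of_mem_filter S hS), Finset.sum_const,
    Finset.sum_const, nsmul_eq_mul, nsmul_eq_mul, Finset.card_powersetCard, ← mul_assoc δ]
  exact mul_le_mul_of_nonneg_right hB (by positivity)

theorem sum_bernoulli_le (h0 : 0 ≤ ξ) (h1 : ξ ≤ 1) (hδ : 0 ≤ δ)
    (hB : ∀ s : ℕ, ξ * D.card / 2 ≤ s → s ≤ D.card →
      (({S ∈ D.powersetCard s | B S} : Finset (Finset V)).card : ℝ) ≤ δ * D.card.choose s) :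
    ∑ S ∈ D.powerset with B S, ξ ^ S.card * (1 - ξ) ^ (D.card - S.card) ≤
      Real.exp (-(ξ * D.card / 10)) + δ := by
  have h1' : 0 ≤ 1 - ξ := sub_nonneg.mpr h1
  have hw : ∀ S : Finset V, 0 ≤ ξ ^ S.card * (1 - ξ) ^ (D.card - S.card) := fun S => by
    positivity
  rw [← Finset.sum_filter_add_sum_filter_not _
    (fun S : Finset V => (S.card : ℝ) < ξ * D.card / 2)]
  refine add_le_add ?_ ?_
  · refine le_trans ?_ (sum_bernoulli_small_le D h0 h1)
    refine Finset.sum_le_sum_of_subset_of_nonneg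
      (Finset.filter_subset_filter _ (Finset.filter_subset _ _)) fun S _ _ => hw S
  · rw [Finset.filter_filter, Finset.sum_filter, Finset.sum_powerset]
    calc _ ≤ ∑ s ∈ Finset.range (D.card + 1),
          δ * ∑ S ∈ D.powersetCard s, ξ ^ S.card * (1 - ξ) ^ (D.card - S.card) := by
          refine Finset.sum_le_sum fun s hs => ?_
          by_cases hsmall : (s : ℝ) < ξ * D.card / 2
          · refine le_trans (le_of_eq ?_)
              (mul_nonneg hδ (Finset.sum_nonneg fun S _ => hw S))
            refine Finset.sum_eq_zero fun S hS => if_neg fun h => h.2 ?_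
            rwa [(Finset.mem_powersetCard.mp hS).2]
          · refine le_trans ?_ (sum_bernoulli_card_eq_le D B s h0 h1
              (hB s (not_lt.mp hsmall) (by simpa [Nat.lt_succ_iff] using hs)))
            rw [Finset.sum_filter]
            refine Finset.sum_le_sum fun S _ => ?_
            split_ifs with h2 h3
            · exact le_rfl
            · exact absurd h2.1 h3
            · exact hw S
            · exact le_rfl
      _ = δ := by
          rw [← Finset.mul_sum, ← Finset.sum_powerset, Finset.sum_pow_mul_eq_add_pow]
          simp

end Bernoulli

/-- The size of the exponent that brings the error of the union bound below `θ / 2`. The factors `2`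
on both sides are absorbed by `k * log n ≥ log 2`. -/
theorem two_mul_pow_mul_exp_le {n k : ℕ} (hn : 2 ≤ n) (hk : 1 ≤ k) {θ x : ℝ} (hθ : 0 < θ)
    (hθ1 : θ < 1) (hx : 3 * (Real.log (1 / θ) + k * Real.log n) ≤ x) :
    2 * (n : ℝ) ^ k * Real.exp (-x) ≤ θ / 2 := by
  have hn0 : (0 : ℝ) < n := by positivity
  have hl2 : Real.log 2 ≤ k * Real.log n := by
    have h1 : Real.log 2 ≤ Real.log n := Real.log_le_log (by norm_num) (by exact_mod_cast hn)
    have h2 : (1 : ℝ) ≤ k := by exact_mod_cast hk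
    exact h1.trans (le_mul_of_one_le_left ((Real.log_nonneg one_le_two).trans h1) h2)
  have hlθ : 0 ≤ Real.log (1 / θ) := Real.log_nonneg (by rw [le_div_iff₀ hθ]; linarith)
  have e1 : (n : ℝ) ^ k = Real.exp (k * Real.log n) := by
    rw [Real.exp_nat_mul, Real.exp_log hn0]
  have e2 : θ / 2 = Real.exp (-Real.log (1 / θ) - Real.log 2) := by
    rw [Real.exp_sub, Real.exp_log two_pos, one_div, Real.log_inv, neg_neg, Real.exp_log hθ]
  have e3 : (2 : ℝ) = Real.exp (Real.log 2) := (Real.exp_log two_pos).symm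
  rw [e1, e2]
  nth_rewrite 1 [e3]
  rw [← Real.exp_add, ← Real.exp_add]
  refine Real.exp_le_exp.mpr ?_
  linarith

/-! ### The law of the sampling scheme -/

section Scheme

variable {V : Type u} {O : Type v}

theorem sampleLaw_apply_of_subset (ξ : ℝ≥0) (hξ : ξ ≤ 1) {D S : Finset V} (h : S ⊆ D) :
    sampleLaw ξ hξ D S = ((ξ ^ S.card * (1 - ξ) ^ (D.card - S.card) : ℝ≥0) : ℝ≥0∞) :=
  if_pos h

theorem sampleLaw_apply_of_not_subset (ξ : ℝ≥0) (hξ : ξ ≤ 1) {D S : Finset V} (h : ¬ S ⊆ D) :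
    sampleLaw ξ hξ D S = 0 :=
  if_neg h

theorem tsum_sampleLaw_mul (ξ : ℝ≥0) (hξ : ξ ≤ 1) (D : Finset V) (a : Finset V → ℝ≥0∞) :
    ∑' S, sampleLaw ξ hξ D S * a S =
      ∑ S ∈ D.powerset, ((ξ ^ S.card * (1 - ξ) ^ (D.card - S.card) : ℝ≥0) : ℝ≥0∞) * a S := by
  rw [tsum_eq_sum (s := D.powerset)]
  · refine Finset.sum_congr rfl fun S hS => ?_
    rw [sampleLaw_apply_of_subset ξ hξ (Finset.mem_powerset.mp hS)]
  · intro S hS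
    rw [sampleLaw_apply_of_not_subset ξ hξ (fun h => hS (Finset.mem_powerset.mpr h)), zero_mul]

open Classical in
theorem sampleLaw_toOuterMeasure (ξ : ℝ≥0) (hξ : ξ ≤ 1) (D : Finset V) (G : Set (Finset V)) :
    (sampleLaw ξ hξ D).toOuterMeasure G = ENNReal.ofReal
      (∑ S ∈ D.powerset with S ∈ G, (ξ : ℝ) ^ S.card * (1 - ξ) ^ (D.card - S.card)) := by
  have h := tsum_sampleLaw_mul ξ hξ D (G.indicator 1)
  have h1 : (1 - (ξ : ℝ)) = ((1 - ξ : ℝ≥0) : ℝ) := (NNReal.coe_sub hξ).symm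
  rw [PMF.toOuterMeasure_apply]
  refine Eq.trans (tsum_congr fun S => ?_) (h.trans ?_)
  · by_cases hS : S ∈ G <;> simp [hS]
  · rw [h1, Finset.sum_filter, ENNReal.ofReal_sum_of_nonneg]
    · refine Finset.sum_congr rfl fun S _ => ?_
      by_cases hS : S ∈ G
      · simp only [hS, Set.indicator_of_mem, Pi.one_apply, mul_one, if_true]
        rw [← NNReal.coe_pow, ← NNReal.coe_pow, ← NNReal.coe_mul, ENNReal.ofReal_coe_nnreal]
      · simp [hS]
    · intro S _
      split_ifs <;> positivity

theorem schemeLaw_toOuterMeasure (A : RandAlg.{u, v, w} (Finset V) O) (ξ : ℝ≥0) (hξ : ξ ≤ 1)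
    (D : Finset V) (E : Set (Finset V × (O × ℕ))) :
    (schemeLaw A ξ hξ D).toOuterMeasure E =
      ∑' S, sampleLaw ξ hξ D S * (A.law S).toOuterMeasure {r | (S, r) ∈ E} := by
  rw [schemeLaw, PMF.toOuterMeasure_bind_apply]
  refine tsum_congr fun S => ?_
  rw [PMF.toOuterMeasure_map_apply]
  rfl

theorem schemeOutput_toOuterMeasure (A : RandAlg.{u, v, w} (Finset V) O) (ξ : ℝ≥0) (hξ : ξ ≤ 1)
    (D : Finset V) (E : Set O) :
    (schemeOutput A ξ hξ D).toOuterMeasure E =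
      ∑' S, sampleLaw ξ hξ D S * (A.outputLaw S).toOuterMeasure E := by
  rw [schemeOutput, PMF.toOuterMeasure_map_apply, schemeLaw_toOuterMeasure]
  refine tsum_congr fun S => ?_
  rw [RandAlg.outputLaw, PMF.toOuterMeasure_map_apply]
  rfl

/-- The sample is the first component of the outcome of the scheme. -/
theorem schemeLaw_sample (A : RandAlg.{u, v, w} (Finset V) O) (ξ : ℝ≥0) (hξ : ξ ≤ 1)
    (D : Finset V) (G : Set (Finset V)) :
    (schemeLaw A ξ hξ D).toOuterMeasure {ω | ω.1 ∈ G} = (sampleLaw ξ hξ D).toOuterMeasure G := by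
  have h : (schemeLaw A ξ hξ D).map Prod.fst = sampleLaw ξ hξ D := by
    rw [schemeLaw, PMF.map_bind]
    refine Eq.trans ?_ (PMF.bind_pure _)
    congr 1
    funext S
    rw [PMF.map_comp]
    exact PMF.map_const _ _
  rw [← h, PMF.toOuterMeasure_map_apply]
  rfl

/-- If the algorithm succeeds with probability at least `q` on each sample in `G`, then the scheme
succeeds with probability at least `q` times that of `G`. -/
theorem mul_sampleLaw_le_schemeLaw (A : RandAlg.{u, v, w} (Finset V) O) (ξ : ℝ≥0) (hξ : ξ ≤ 1)
    (D : Finset V) (G : Set (Finset V)) (E : Set (Finset V × (O × ℕ))) (q : ℝ≥0∞)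
    (h : ∀ S ∈ G, q ≤ (A.law S).toOuterMeasure {r | (S, r) ∈ E}) :
    q * (sampleLaw ξ hξ D).toOuterMeasure G ≤ (schemeLaw A ξ hξ D).toOuterMeasure E := by
  classical
  rw [schemeLaw_toOuterMeasure, PMF.toOuterMeasure_apply, ← ENNReal.tsum_mul_left]
  refine ENNReal.tsum_le_tsum fun S => ?_
  by_cases hS : S ∈ G
  · rw [Set.indicator_of_mem hS, mul_comm]
    gcongr
    exact h S hS
  · rw [Set.indicator_of_notMem hS, mul_zero]
    exact zero_le

theorem subset_and_steps_le_of_mem_support {A : RandAlg.{u, v, w} (Finset V) O} {T : ℕ → ℕ}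
    (hT : RunsInTime A T) (ξ : ℝ≥0) (hξ : ξ ≤ 1) (D : Finset V)
    (ω : Finset V × (O × ℕ)) (hω : ω ∈ (schemeLaw A ξ hξ D).support) :
    ω.1 ⊆ D ∧ ω.2.2 ≤ T ω.1.card := by
  rw [schemeLaw, PMF.mem_support_bind_iff] at hω
  obtain ⟨S, hS, hω⟩ := hω
  obtain ⟨r, hr, rfl⟩ := (PMF.mem_support_map_iff _ _ _).mp hω
  refine ⟨?_, hT S r hr⟩
  by_contra h
  exact (PMF.mem_support_iff _ _).mp hS (sampleLaw_apply_of_not_subset ξ hξ h)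

/-! ### Privacy amplification by subsampling -/

/-- Conditioning on whether the added point is sampled. -/
theorem sum_bernoulli_insert [DecidableEq V] (ξ : ℝ≥0) {D : Finset V} {x : V} (hx : x ∉ D)
    (a : Finset V → ℝ≥0∞) :
    ∑ S ∈ (insert x D).powerset,
        ((ξ ^ S.card * (1 - ξ) ^ ((insert x D).card - S.card) : ℝ≥0) : ℝ≥0∞) * a S =
      ∑ S ∈ D.powerset, ((ξ ^ S.card * (1 - ξ) ^ (D.card - S.card) : ℝ≥0) : ℝ≥0∞) *
        (((1 - ξ : ℝ≥0) : ℝ≥0∞) * a S + (ξ : ℝ≥0∞) * a (insert x S)) := by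
  rw [Finset.sum_powerset_insert hx, ← Finset.sum_add_distrib]
  refine Finset.sum_congr rfl fun S hS => ?_
  have hSD := Finset.mem_powerset.mp hS
  have hc := Finset.card_le_card hSD
  rw [Finset.card_insert_of_notMem hx, Finset.card_insert_of_notMem fun h => hx (hSD h),
    Nat.add_sub_add_right, Nat.succ_sub hc, pow_succ, pow_succ]
  push_cast
  ring

theorem mul_exp_sub_one_add_one_pos (x : ℝ) {ξ : ℝ≥0} (hξ : ξ ≤ 1) :
    0 < (ξ : ℝ) * (Real.exp x - 1) + 1 := by
  have h1 : (ξ : ℝ) ≤ 1 := hξ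
  rcases ξ.coe_nonneg.eq_or_lt with h | h
  · rw [← h]; norm_num
  · nlinarith [mul_pos h (Real.exp_pos x)]

theorem exp_subsampledEps (ε : ℝ) {ξ : ℝ≥0} (hξ : ξ ≤ 1) :
    Real.exp (subsampledEps ε ξ) =
      max ((ξ : ℝ) * (Real.exp ε - 1) + 1) ((ξ : ℝ) * (Real.exp (-ε) - 1) + 1)⁻¹ := by
  exact Real.exp_log (lt_max_of_lt_left (mul_exp_sub_one_add_one_pos ε hξ))

/-- `a` and `b` stand for the probabilities of an event without and with the added point in the
sample; the mixture on the left is its probability when the point is sampled with probability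
`ξ`. -/
theorem mix_le (ε : ℝ) {ξ : ℝ≥0} (hξ : ξ ≤ 1) {a b : ℝ≥0∞} (ha : a ≠ ∞)
    (hb : b ≠ ∞) (hba : b ≤ ENNReal.ofReal (Real.exp ε) * a) :
    ((1 - ξ : ℝ≥0) : ℝ≥0∞) * a + (ξ : ℝ≥0∞) * b ≤
      ENNReal.ofReal (Real.exp (subsampledEps ε ξ)) * a := by
  lift a to ℝ≥0 using ha
  lift b to ℝ≥0 using hb
  rw [ENNReal.ofReal] at hba ⊢
  norm_cast at hba ⊢
  rw [← NNReal.coe_le_coe] at hba ⊢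
  push_cast [NNReal.coe_sub hξ, Real.coe_toNNReal _ (Real.exp_nonneg _)] at hba ⊢
  rw [exp_subsampledEps ε hξ]
  calc (1 - (ξ : ℝ)) * a + ξ * b ≤ (1 - (ξ : ℝ)) * a + ξ * (Real.exp ε * a) := by gcongr
    _ = ((ξ : ℝ) * (Real.exp ε - 1) + 1) * a := by ring
    _ ≤ _ := by gcongr; exact le_max_left _ _

/-- The converse comparison to `mix_le`, which needs the second term of the maximum. -/
theorem le_mix (ε : ℝ) {ξ : ℝ≥0} (hξ : ξ ≤ 1) {a b : ℝ≥0∞} (ha : a ≠ ∞)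
    (hb : b ≠ ∞) (hab : a ≤ ENNReal.ofReal (Real.exp ε) * b) :
    a ≤ ENNReal.ofReal (Real.exp (subsampledEps ε ξ)) *
      (((1 - ξ : ℝ≥0) : ℝ≥0∞) * a + (ξ : ℝ≥0∞) * b) := by
  lift a to ℝ≥0 using ha
  lift b to ℝ≥0 using hb
  rw [ENNReal.ofReal] at hab ⊢
  norm_cast at hab ⊢
  rw [← NNReal.coe_le_coe] at hab ⊢
  push_cast [NNReal.coe_sub hξ, Real.coe_toNNReal _ (Real.exp_nonneg _)] at hab ⊢
  rw [exp_subsampledEps ε hξ]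
  have h1 : (0 : ℝ) ≤ 1 - ξ := sub_nonneg.mpr hξ
  have hpos := mul_exp_sub_one_add_one_pos (-ε) hξ
  have hab' : Real.exp (-ε) * a ≤ b := by
    rw [Real.exp_neg, inv_mul_le_iff₀ (Real.exp_pos ε)]
    exact hab
  calc (a : ℝ) = ((ξ : ℝ) * (Real.exp (-ε) - 1) + 1)⁻¹ *
        ((1 - (ξ : ℝ)) * a + ξ * (Real.exp (-ε) * a)) := by
        field_simp
        ring
    _ ≤ ((ξ : ℝ) * (Real.exp (-ε) - 1) + 1)⁻¹ * ((1 - (ξ : ℝ)) * a + ξ * b) := by gcongr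
    _ ≤ _ := by gcongr; exact le_max_right _ _

theorem toOuterMeasure_ne_top (p : PMF O) (E : Set O) : p.toOuterMeasure E ≠ ∞ := by
  refine ne_top_of_le_ne_top ENNReal.one_ne_top ?_
  rw [PMF.toOuterMeasure_apply, ← p.tsum_coe]
  exact ENNReal.tsum_le_tsum fun x => Set.indicator_le_self _ _ x

/-- **Privacy amplification by subsampling**: pointwise in the part of the sample outside the added
point, the two probabilities compare by `mix_le` and `le_mix`. -/
theorem isDP_schemeOutput {A : RandAlg.{u, v, w} (Finset V) O} {ε : ℝ} (hA : IsDP A.outputLaw ε)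
    (ξ : ℝ≥0) (hξ : ξ ≤ 1) : IsDP (schemeOutput A ξ hξ) (subsampledEps ε ξ) := by
  classical
  have hnb : ∀ {x : V} {D : Finset V}, x ∉ D → Neighboring D (insert x D) := fun {x D} hx =>
    Or.inl ⟨Finset.subset_insert x D, Finset.card_insert_of_notMem hx⟩
  have hins : ∀ D D' : Finset V, D ⊆ D' → D'.card = D.card + 1 →
      ∃ x, x ∉ D ∧ D' = insert x D := by
    intro D D' hsub hcard
    obtain ⟨x, hx⟩ := Finset.card_eq_one.mp
      (show (D' \ D).card = 1 by rw [Finset.card_sdiff_of_subset hsub]; omega)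
    refine ⟨x, (Finset.mem_sdiff.mp (hx ▸ Finset.mem_singleton_self x)).2, ?_⟩
    rw [← Finset.sdiff_union_of_subset hsub, hx, Finset.insert_eq]
  intro D D' hDD' E
  rw [schemeOutput_toOuterMeasure, schemeOutput_toOuterMeasure, tsum_sampleLaw_mul,
    tsum_sampleLaw_mul]
  rcases hDD' with ⟨hsub, hcard⟩ | ⟨hsub, hcard⟩
  · obtain ⟨x, hx, rfl⟩ := hins D D' hsub hcard
    rw [sum_bernoulli_insert ξ hx, Finset.mul_sum]
    refine Finset.sum_le_sum fun S hS => ?_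
    have hxS : x ∉ S := fun h => hx (Finset.mem_powerset.mp hS h)
    rw [mul_left_comm]
    gcongr
    exact le_mix ε hξ (toOuterMeasure_ne_top _ _) (toOuterMeasure_ne_top _ _)
      (hA _ _ (hnb hxS) E)
  · obtain ⟨x, hx, rfl⟩ := hins D' D hsub hcard
    rw [sum_bernoulli_insert ξ hx, Finset.mul_sum]
    refine Finset.sum_le_sum fun S hS => ?_
    have hxS : x ∉ S := fun h => hx (Finset.mem_powerset.mp hS h)
    rw [mul_left_comm]
    gcongr
    exact mix_le ε hξ (toOuterMeasure_ne_top _ _) (toOuterMeasure_ne_top _ _)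
      (hA _ _ (hnb hxS).symm E)

end Scheme

/-! ### The probability of a representative sample -/

section SampleBounds

variable {V : Type u}

theorem le_sampleLaw_inter_card (ξ : ℝ≥0) (hξ : ξ ≤ 1) (D : Finset V) (B : Finset V → Prop)
    [DecidablePred B] {δ : ℝ} (hδ : δ ≤ 1) (s : ℕ)
    (hB : s ≤ D.card →
      (({S ∈ D.powersetCard s | B S} : Finset (Finset V)).card : ℝ) ≤ δ * D.card.choose s) :
    ENNReal.ofReal (1 - δ) * (sampleLaw ξ hξ D).toOuterMeasure {S | S.card = s} ≤
      (sampleLaw ξ hξ D).toOuterMeasure {S | S.card = s ∧ ¬ B S} := by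
  classical
  have hf : {S ∈ D.powerset | S.card = s} = D.powersetCard s := by
    ext S
    simp [Finset.mem_powersetCard]
  rw [sampleLaw_toOuterMeasure, sampleLaw_toOuterMeasure,
    ← ENNReal.ofReal_mul (sub_nonneg.mpr hδ)]
  refine ENNReal.ofReal_le_ofReal ?_
  simp only [Set.mem_ofPred_eq]
  rw [← Finset.filter_filter, hf]
  by_cases hs : s ≤ D.card
  · have h := sum_bernoulli_card_eq_le D B s ξ.coe_nonneg hξ (hB hs)
    have h2 := Finset.sum_filter_add_sum_filter_not (D.powersetCard s) B
      fun S => (ξ : ℝ) ^ S.card * (1 - ξ) ^ (D.card - S.card)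
    linarith
  · rw [Finset.powersetCard_eq_empty.mpr (not_le.mp hs)]
    simp

theorem le_sampleLaw_not (ξ : ℝ≥0) (hξ : ξ ≤ 1) (D : Finset V) (B : Finset V → Prop)
    [DecidablePred B] {δ : ℝ} (hδ : 0 ≤ δ)
    (hB : ∀ s : ℕ, (ξ : ℝ) * D.card / 2 ≤ s → s ≤ D.card →
      (({S ∈ D.powersetCard s | B S} : Finset (Finset V)).card : ℝ) ≤ δ * D.card.choose s) :
    ENNReal.ofReal (1 - (Real.exp (-(ξ * D.card / 10)) + δ)) ≤
      (sampleLaw ξ hξ D).toOuterMeasure {S | ¬ B S} := by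
  classical
  rw [sampleLaw_toOuterMeasure]
  refine ENNReal.ofReal_le_ofReal ?_
  simp only [Set.mem_ofPred_eq]
  have h := sum_bernoulli_le D B ξ.coe_nonneg hξ hδ hB
  have h2 := Finset.sum_filter_add_sum_filter_not D.powerset B
    fun S => (ξ : ℝ) ^ S.card * (1 - ξ) ^ (D.card - S.card)
  rw [Finset.sum_pow_mul_eq_add_pow, add_sub_cancel, one_pow] at h2
  linarith

end SampleBounds

end PrivateClustering

/-! ### Privacy and accuracy of the sampling scheme for k-means -/

theorem mainTheorem7 :
    ∃ c : ℝ, 0 < c ∧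
      ∀ (V : Type u) [Fintype V] [MetricSpace V] (M : ℝ)
        (_hM : M = Metric.diam (Set.univ : Set V))
        (n : ℕ) (_hn : n = Fintype.card V)
        (k : ℕ) (_hk : 1 ≤ k) (_hkn : k ≤ n)
        (ε : ℝ) (_hε : 0 < ε)
        (K : ℝ) (_hK : 0 ≤ K)
        (γ : ℝ) (_hγ : γ = K * ((M ^ 2 * (k : ℝ) ^ 4 / ε) * Real.log n ^ 2))
        (p : ℝ) (_hp : p ∈ Set.Icc (0 : ℝ) 1)
        (T : ℕ → ℕ)
        (A : PrivateClustering.RandAlg.{u, u, w} (Finset V) (PrivateClustering.Centers V k))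
        (_hdp : PrivateClustering.IsDP A.outputLaw ε)
        (_happrox : PrivateClustering.IsApproxKMeans A 30 γ p)
        (_htime : PrivateClustering.RunsInTime A T)
        (ξ : ℝ≥0) (hξ : ξ ≤ 1),
        -- privacy of the sampling scheme
        PrivateClustering.IsDP (PrivateClustering.schemeOutput A ξ hξ)
            (PrivateClustering.subsampledEps ε ξ) ∧
        ∀ (D : Finset V) (_hD : D.Nonempty) (θ : ℝ) (_hθ : θ ∈ Set.Ioo (0 : ℝ) 1)
          (η : ℝ) (_hη : 0 < η)
          (good : Set (Finset V × (PrivateClustering.Centers V k × ℕ)))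
          (_hgood : good = {ω |
            PrivateClustering.costMeanAvg D ω.2.1.1 ≤
                30 * PrivateClustering.meanAvg D k + γ + η ∧
            PrivateClustering.costMeanAvg ω.1 ω.2.1.1 ≤
                30 * PrivateClustering.meanAvg D k + γ + η})
          (s₀ : ℝ)
          (_hs₀ : s₀ = c * max (M ^ 2 * Real.log (1 / θ) / η)
            (M ^ 4 / η ^ 2 * (Real.log (1 / θ) + k * Real.log n))),
          -- the sample is a subset of the input, the clustering is computed from it in time `T |S|`
          (∀ ω ∈ (PrivateClustering.schemeLaw A ξ hξ D).support,
            ω.1 ⊆ D ∧ ω.2.2 ≤ T ω.1.card) ∧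
          -- accuracy, given that the sample has a certain size `s ≥ s₀`
          (∀ s : ℕ, s₀ ≤ s →
            ENNReal.ofReal ((1 - θ) * (1 - p)) *
                (PrivateClustering.schemeLaw A ξ hξ D).toOuterMeasure {ω | ω.1.card = s} ≤
              (PrivateClustering.schemeLaw A ξ hξ D).toOuterMeasure
                ({ω | ω.1.card = s} ∩ good)) ∧
          -- accuracy, if the expected sample size is at least `s₀`
          (s₀ ≤ ξ * D.card →
            ENNReal.ofReal ((1 - θ) * (1 - p)) ≤
              (PrivateClustering.schemeLaw A ξ hξ D).toOuterMeasure good) := by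
  classical
  refine ⟨50000, by norm_num, ?_⟩
  intro V _ _ M hM n hn k hk hkn ε hε K hK γ hγ p hp T A hdp happrox htime ξ hξ
  refine ⟨PrivateClustering.isDP_schemeOutput hdp ξ hξ, ?_⟩
  intro D hD θ hθ η hη good hgood s₀ hs₀
  refine ⟨fun ω hω => PrivateClustering.subset_and_steps_le_of_mem_support htime ξ hξ D ω hω, ?_⟩
  subst hgood
  have hθ0 : 0 ≤ 1 - θ := sub_nonneg.mpr hθ.2.le
  have hp0 : 0 ≤ 1 - p := sub_nonneg.mpr hp.2
  have hγ0 : 0 ≤ γ := by rw [hγ]; positivity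
  have hq : ENNReal.ofReal ((1 - θ) * (1 - p)) ≤ 1 := by
    refine ENNReal.ofReal_le_one.mpr (mul_le_one₀ ?_ hp0 ?_)
    · linarith [hθ.1]
    · linarith [hp.1]
  rcases le_or_gt (M ^ 2) η with hMη | hMη
  · -- no clustering has average cost above `M ^ 2 ≤ η`, so every outcome is good
    have hall : ∀ ω : Finset V × (PrivateClustering.Centers V k × ℕ), ω ∈ {ω |
        PrivateClustering.costMeanAvg D ω.2.1.1 ≤
            30 * PrivateClustering.meanAvg D k + γ + η ∧
        PrivateClustering.costMeanAvg ω.1 ω.2.1.1 ≤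
            30 * PrivateClustering.meanAvg D k + γ + η} := by
      intro ω
      have hC : ω.2.1.1.Nonempty := Finset.card_pos.mp (by rw [ω.2.1.2]; omega)
      have hmean : 0 ≤ PrivateClustering.meanAvg D k :=
        div_nonneg (PrivateClustering.optMeansCost_nonneg D k) (Nat.cast_nonneg _)
      have h : ∀ U, PrivateClustering.costMeanAvg U ω.2.1.1 ≤
          30 * PrivateClustering.meanAvg D k + γ + η := fun U => by
        have := PrivateClustering.costMeanAvg_le_sq_diam U ω.2.1.1 hC
        rw [← hM] at this
        linarith
      exact ⟨h D, h ω.1⟩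
    rw [Set.eq_univ_of_forall hall]
    refine ⟨fun s _ => ?_, fun _ => ?_⟩
    · rw [Set.inter_univ]
      exact mul_le_of_le_one_left zero_le hq
    · rw [(PMF.toOuterMeasure_apply_eq_one_iff _ _).mpr (Set.subset_univ _)]
      exact hq
  -- from here on `0 < M`, and `s₀` is at least `50000 * L` and `50000 * (M ^ 4 / η ^ 2) * L`
  have hM0 : 0 < M := by
    refine lt_of_le_of_ne (by rw [hM]; exact Metric.diam_nonneg) fun h => ?_
    rw [← h] at hMη
    norm_num at hMη
    linarith
  have hn2 : 2 ≤ n := by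
    rw [hn]
    exact PrivateClustering.two_le_card_of_diam_pos (hM ▸ hM0)
  set L : ℝ := Real.log (1 / θ) + k * Real.log n with hL
  have hL0 : 0 ≤ L := by
    refine add_nonneg (Real.log_nonneg ?_)
      (mul_nonneg (Nat.cast_nonneg _) (Real.log_natCast_nonneg n))
    rw [le_div_iff₀ hθ.1]
    linarith [hθ.2]
  have hs₀L : 50000 * (M ^ 4 / η ^ 2 * L) ≤ s₀ := by
    rw [hs₀]
    gcongr
    exact le_max_right _ _
  have hLs : L ≤ M ^ 4 / η ^ 2 * L := by
    refine le_mul_of_one_le_left hL0 ?_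
    rw [one_le_div (by positivity)]
    nlinarith
  -- samples of size at least `s₀ / 2` are representative with high probability
  have hbad : ∀ s : ℕ, s₀ / 2 ≤ s → s ≤ D.card →
      (({S ∈ D.powersetCard s | ¬ PrivateClustering.Represents D k (η / 60) S} :
        Finset (Finset V)).card : ℝ) ≤ θ / 2 * D.card.choose s := by
    intro s hs hsD
    refine (PrivateClustering.card_not_represents_le hM hM0 hk (by positivity) D hsD).trans ?_
    gcongr
    rw [← hn]
    refine PrivateClustering.two_mul_pow_mul_exp_le hn2 hk hθ.1 hθ.2 ?_
    rw [← hL, le_div_iff₀ (by positivity)]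
    have h1 : 25000 * (M ^ 4 / η ^ 2 * L) ≤ s := by linarith
    have h2 : 25000 * (M ^ 4 / η ^ 2 * L) * η ^ 2 ≤ s * η ^ 2 := by gcongr
    have h3 : 25000 * (M ^ 4 / η ^ 2 * L) * η ^ 2 = 25000 * (M ^ 4 * L) := by field_simp
    have h4 : 0 ≤ M ^ 4 * L := by positivity
    nlinarith
  -- on a representative sample it suffices that the algorithm meets its guarantee
  have hsucc : ∀ S, PrivateClustering.Represents D k (η / 60) S → ENNReal.ofReal (1 - p) ≤
      (A.law S).toOuterMeasure {r | (S, r) ∈ {ω : Finset V × (PrivateClustering.Centers V k × ℕ) |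
        PrivateClustering.costMeanAvg D ω.2.1.1 ≤
            30 * PrivateClustering.meanAvg D k + γ + η ∧
        PrivateClustering.costMeanAvg ω.1 ω.2.1.1 ≤
            30 * PrivateClustering.meanAvg D k + γ + η}} := by
    intro S hS
    refine (happrox S).trans ?_
    rw [PrivateClustering.RandAlg.outputLaw, PMF.toOuterMeasure_map_apply]
    refine MeasureTheory.measure_mono fun r hr => ?_
    exact PrivateClustering.costMeanAvg_le_of_represents (hn ▸ hkn) hγ0 hη hS r.1 hr
  refine ⟨fun s hs => ?_, fun hs => ?_⟩
  · have hs0 : 0 ≤ s₀ := by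
      refine le_trans ?_ hs₀L
      positivity
    refine le_trans ?_ (PrivateClustering.mul_sampleLaw_le_schemeLaw A ξ hξ D
      {S | S.card = s ∧ ¬ ¬ PrivateClustering.Represents D k (η / 60) S} _
      (ENNReal.ofReal (1 - p)) fun S hS => ?_)
    · rw [mul_comm (1 - θ), ENNReal.ofReal_mul hp0, mul_assoc]
      gcongr
      refine le_trans (le_of_eq ?_) (PrivateClustering.le_sampleLaw_inter_card ξ hξ D _ hθ.2.le s
        fun hsD => (hbad s (by linarith) hsD).trans ?_)
      · rw [← PrivateClustering.schemeLaw_sample A]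
        rfl
      · gcongr
        linarith [hθ.1]
    · refine (hsucc S (not_not.mp hS.2)).trans (MeasureTheory.measure_mono fun r hr => ?_)
      exact ⟨hS.1, hr⟩
  · refine le_trans ?_ (PrivateClustering.mul_sampleLaw_le_schemeLaw A ξ hξ D
      {S | ¬ ¬ PrivateClustering.Represents D k (η / 60) S} _
      (ENNReal.ofReal (1 - p)) fun S hS => hsucc S (not_not.mp hS))
    rw [mul_comm (1 - θ), ENNReal.ofReal_mul hp0]
    gcongr
    refine le_trans (ENNReal.ofReal_le_ofReal ?_) (PrivateClustering.le_sampleLaw_not ξ hξ D _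
      (half_pos hθ.1).le fun s hsm hsD => hbad s (by linarith) hsD)
    have hsize : Real.exp (-(ξ * D.card / 10)) ≤ θ / 2 := by
      have h := PrivateClustering.two_mul_pow_mul_exp_le (x := ξ * D.card / 10) hn2 hk hθ.1 hθ.2
        (by rw [← hL]; linarith)
      refine le_trans (le_mul_of_one_le_left (Real.exp_nonneg _) ?_) h
      have : (1 : ℝ) ≤ (n : ℝ) ^ k := one_le_pow₀ (by exact_mod_cast (by omega : 1 ≤ n))
      linarith
    linarith
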